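/- Let $\mathcal H$ be a complex Hilbert space with orthonormal basis $\{|n\rangle\}_{n\ge 0}$ (the Fock basis of a single harmonic oscillator), with annihilation and creation operators $a|n\rangle=\sqrt n\,|n-1\rangle$, $a^\dagger|n\rangle=\sqrt{n+1}\,|n+1\rangle$. For $\alpha\in\mathbb C$ let $|\alpha\rangle=e^{-|\alpha|^2/2}\sum_{n\ge0}\frac{\alpha^n}{\sqrt{n!}}|n\rangle$ be the coherent state, and let the set $\mathcal C$ of classical states be the trace-norm closed convex hull of $\{|\alpha\rangle\langle\alpha| : \alpha\in\mathbb C\}$. For a density operator $\rho$ define the (generalized) nonclassicality robustness $$R_{\mathcal C}(\rho)=\inf\Big\{1+\lambda \;:\; \lambda\ge 0,\ \tfrac{\xi_k+\lambda\tau_k}{1+\lambda}\in\mathcal C \text{ for all } k,\ \tau_k \text{ density operators},\ \xi_k\in\mathcal B(\mathcal H),\ \|\xi_k-\rho\|_1\to 0\Big\}\in[1,\infty].$$ For $r\ge 0$ let $|\zeta_r\rangle=e^{r(a^2-a^{\dagger 2})/2}|0\rangle$ be the squeezed vacuum, i.e. the value at $t=r$ of the solution $\psi:\mathbb R\to\mathcal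 H$ of $\psi'(t)=A\psi(t)$, $\psi(0)=|0\rangle$, where $A$ is the closure of $\tfrac12(a^2-a^{\dagger2})$ defined on finite linear combinations of Fock states. Then for every $r\ge0$ the vector $|\zeta_r\rangle$ is well defined (it exists and is unique) and $$R_{\mathcal C}\big(|\zeta_r\rangle\langle\zeta_r|\big)=e^{r}.$$ -/

import Mathlib

open scoped ENNReal NNReal Topology Nat

noncomputable section

namespace SqueezedRobustness

/- The Hilbert space of a single harmonic oscillator is a complex Hilbert space `H` with an
orthonormal basis `b` indexed by `ℕ`; the Fock state `|n⟩` is `b n`. -/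
variable {H : Type*} [NormedAddCommGroup H] [InnerProductSpace ℂ H] [CompleteSpace H]

/-- The rank-one operator `|ψ⟩⟨ψ|`. -/
def proj (ψ : H) : H →L[ℂ] H := InnerProductSpace.rankOne ℂ ψ ψ

/-! ### Trace norm and density operators -/

/-- The trace norm `‖T‖₁ = Tr |T|`, where `|T| = √(T* T)`; it is `∞` if `T` is not trace class. -/
def traceNorm (b : HilbertBasis ℕ ℂ H) (T : H →L[ℂ] H) : ℝ≥0∞ :=
  ∑' n : ℕ, ENNReal.ofReal (inner ℂ (b n) (CFC.abs T (b n))).re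

/-- Density operators: positive operators of trace one. -/
def IsDensity (b : HilbertBasis ℕ ℂ H) (ρ : H →L[ℂ] H) : Prop :=
  ρ.IsPositive ∧ HasSum (fun n : ℕ => inner ℂ (b n) (ρ (b n))) (1 : ℂ)

/-- Convergence of a sequence of bounded operators in trace norm. -/
def TraceTendsto (b : HilbertBasis ℕ ℂ H) (ξ : ℕ → (H →L[ℂ] H)) (ρ : H →L[ℂ] H) : Prop :=
  Filter.Tendsto (fun k => traceNorm b (ξ k - ρ)) Filter.atTop (𝓝 0)

/-- The closure of a set of bounded operators in trace norm. -/
def traceClosure (b : HilbertBasis ℕ ℂ H) (S : Set (H →L[ℂ] H)) : Set (H →L[ℂ] H) :=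
  {σ | ∃ c : ℕ → (H →L[ℂ] H), (∀ k, c k ∈ S) ∧ TraceTendsto b c σ}

/-! ### The (generalized) robustness with respect to a set of free states -/

/-- The robustness: the infimum of `1 + lam` over `lam ≥ 0` such
that `(ξ_k + lam τ_k) / (1 + lam)` is free for all `k`, for some density operators `τ_k` and some
bounded operators `ξ_k` that converge to `ρ` in trace norm (`∞` if there is no such `lam`). -/
def robustness (b : HilbertBasis ℕ ℂ H) (F : Set (H →L[ℂ] H)) (ρ : H →L[ℂ] H) : ℝ≥0∞ :=
  sInf {x : ℝ≥0∞ | ∃ (lam : ℝ≥0) (ξ τ : ℕ → (H →L[ℂ] H)),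
    x = 1 + (lam : ℝ≥0∞) ∧ (∀ k, IsDensity b (τ k)) ∧ TraceTendsto b ξ ρ ∧
    ∀ k, (1 + (lam : ℝ))⁻¹ • (ξ k + (lam : ℝ) • τ k) ∈ F}

/-! ### Coherent states and classical states -/

/-- The coefficients `e^{-|α|²/2} αⁿ / √(n!)` of a coherent state. -/
def coherentCoeff (α : ℂ) (n : ℕ) : ℂ :=
  (Real.exp (-‖α‖ ^ 2 / 2) : ℂ) * (α ^ n / (Real.sqrt (n ! : ℝ) : ℂ))

theorem coherentCoeff_memℓp (α : ℂ) : Memℓp (coherentCoeff α) 2 := by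
  refine memℓp_gen ?_
  have h : Summable fun n : ℕ => Real.exp (-‖α‖ ^ 2 / 2) ^ 2 * ((‖α‖ ^ 2) ^ n / (n ! : ℝ)) :=
    (Real.summable_pow_div_factorial (‖α‖ ^ 2)).mul_left _
  refine h.congr fun n => ?_
  have hn : (0 : ℝ) ≤ (n ! : ℝ) := by positivity
  simp only [coherentCoeff, ENNReal.toReal_ofNat, Real.rpow_two, norm_mul, norm_div, norm_pow,
    Complex.norm_real, Real.norm_eq_abs, Real.abs_exp, abs_of_nonneg (Real.sqrt_nonneg _),
    mul_pow, div_pow, Real.sq_sqrt hn]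
  ring

/-- The coherent state `|α⟩`. -/
def coherent (b : HilbertBasis ℕ ℂ H) (α : ℂ) : H :=
  b.repr.symm ⟨coherentCoeff α, coherentCoeff_memℓp α⟩

/-- The classical states: the trace-norm closed convex hull of the coherent states. -/
def classicalStates (b : HilbertBasis ℕ ℂ H) : Set (H →L[ℂ] H) :=
  traceClosure b (convexHull ℝ (Set.range fun α : ℂ => proj (coherent b α)))

/-! ### Squeezed vacuum -/

/-- The annihilation operator on finite combinations of Fock states: `a|n⟩ = √n |n-1⟩`
(the value at `n = 0` is `0`). -/
def annihilation : (ℕ →₀ ℂ) →ₗ[ℂ] (ℕ →₀ ℂ) :=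
  Finsupp.linearCombination ℂ fun n : ℕ => Finsupp.single (n - 1) (Real.sqrt n : ℂ)

/-- The creation operator on finite combinations of Fock states: `a†|n⟩ = √(n+1) |n+1⟩`. -/
def creation : (ℕ →₀ ℂ) →ₗ[ℂ] (ℕ →₀ ℂ) :=
  Finsupp.linearCombination ℂ fun n : ℕ => Finsupp.single (n + 1) (Real.sqrt (n + 1) : ℂ)

/-- The operator `(a² - a†²) / 2` on finite combinations of Fock states. -/
def squeezeGen : (ℕ →₀ ℂ) →ₗ[ℂ] (ℕ →₀ ℂ) :=
  (1 / 2 : ℂ) • (annihilation ∘ₗ annihilation - creation ∘ₗ creation)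

/-- Finite combinations of Fock states as vectors of the Fock space. -/
def toFock (b : HilbertBasis ℕ ℂ H) : (ℕ →₀ ℂ) →ₗ[ℂ] H := Finsupp.linearCombination ℂ b

/-- The graph of the closure of the densely defined (skew-symmetric) operator
`(a² - a†²) / 2` on the Fock space. -/
def squeezeGraph (b : HilbertBasis ℕ ℂ H) : Submodule ℂ (H × H) :=
  (LinearMap.range ((toFock b).prod (toFock b ∘ₗ squeezeGen))).topologicalClosure

/-- `ψ` is the orbit `t ↦ e^{t A} v` of the one-parameter group generated by the (unbounded)
operator `A` with graph `G`: `ψ` is differentiable, lies in the domain of `A`, and solves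
`ψ'(t) = A ψ(t)`, `ψ(0) = v`. For skew-symmetric `A` such a `ψ` is unique. -/
def IsExpOrbit (G : Submodule ℂ (H × H)) (v : H) (ψ : ℝ → H) : Prop :=
  ψ 0 = v ∧ ∀ t : ℝ, ∃ w : H, (ψ t, w) ∈ G ∧ HasDerivAt ψ w t

/-- `ζ = e^{r (a² - a†²) / 2} |0⟩`, the squeezed vacuum vector with squeezing parameter `r`. -/
def IsSqueezedVacuum (b : HilbertBasis ℕ ℂ H) (r : ℝ) (ζ : H) : Prop :=
  ∃ ψ : ℝ → H, IsExpOrbit (squeezeGraph b) (b 0) ψ ∧ ψ r = ζ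

end SqueezedRobustness

end

/-!
Against mixtures of unit vectors `f i`, the robustness of a pure state is controlled by the closed
convex hull `K` of the vectors `f i` themselves. If `v ∈ K` is nonzero, operator convexity of
`v ↦ |v⟩⟨v|` puts `|v⟩⟨v|` below a mixture of the `|f i⟩⟨f i|`, up to approximation, so the state
`v / ‖v‖` has robustness at most `‖v‖⁻²`. Conversely, every vector `h` whose overlaps with the
`f i` are at most one bounds the robustness of `ψ` from below by `|⟨h, ψ⟩|²`.

For the coherent states, take for `v` a Gaussian superposition of the `|α⟩` along a line `ℝ c`: its
Fock expansion shows that `v = e^{-|r|/2} ζ_r` for a suitable `c`. The witnesses are the vectors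
`S z = e^{z a†² / 2} |0⟩` with `|z| < 1`: here
`|⟨α, S z⟩| = |exp (z (conj α)² / 2 - |α|² / 2)| ≤ 1`, and `⟨S z, v⟩` tends to `1` as `z` tends
radially to `c² / |c|²`. That `ζ_r` is a multiple of `S (-tanh r)` is checked termwise on the
differential equation, whose solution is unique because its generator is skew-symmetric.
-/

noncomputable section

namespace SqueezedRobustness

open Filter MeasureTheory ProbabilityTheory InnerProductSpace

section HilbertBasis

variable {ι 𝕜 E : Type*} [RCLike 𝕜] [NormedAddCommGroup E] [InnerProductSpace 𝕜 E]

theorem hasSum_norm_inner_sq (b : HilbertBasis ι 𝕜 E) (x : E) :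
    HasSum (fun i => ‖inner 𝕜 (b i) x‖ ^ 2) (‖x‖ ^ 2) := by
  simpa [b.repr_apply_apply] using lp.hasSum_norm (by norm_num) (b.repr x)

theorem tsum_enorm_inner_sq (b : HilbertBasis ι 𝕜 E) (x : E) :
    ∑' i, ‖inner 𝕜 (b i) x‖ₑ ^ 2 = ‖x‖ₑ ^ 2 := by
  have h := hasSum_norm_inner_sq b x
  simpa only [h.tsum_eq, ENNReal.ofReal_pow (norm_nonneg _), ofReal_norm] using
    (ENNReal.ofReal_tsum_of_nonneg (fun i => by positivity) h.summable).symm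

theorem enorm_inner_le_enorm (x y : E) : ‖inner 𝕜 x y‖ₑ ≤ ‖x‖ₑ * ‖y‖ₑ :=
  ENNReal.coe_le_coe.2 (nnnorm_inner_le_nnnorm x y)

theorem enorm_sq_le_tsum_enorm_adjoint_sq [CompleteSpace E] (b : HilbertBasis ι 𝕜 E)
    (S : E →L[𝕜] E) : ‖S‖ₑ ^ 2 ≤ ∑' i, ‖S.adjoint (b i)‖ₑ ^ 2 := by
  set M := ∑' i, ‖S.adjoint (b i)‖ₑ ^ 2
  have hS (x : E) : ‖S x‖ₑ ^ 2 ≤ M * ‖x‖ₑ ^ 2 := by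
    rw [← tsum_enorm_inner_sq b (S x), ← ENNReal.tsum_mul_right]
    refine ENNReal.tsum_le_tsum fun i => ?_
    rw [← S.adjoint_inner_left, ← mul_pow]
    gcongr
    exact enorm_inner_le_enorm _ _
  have hM : (M ^ (2⁻¹ : ℝ)) ^ 2 = M := mod_cast ENNReal.rpow_inv_natCast_pow two_ne_zero M
  calc ‖S‖ₑ ^ 2 ≤ (M ^ (2⁻¹ : ℝ)) ^ 2 := by
        gcongr
        refine S.opENorm_le_bound fun x => (ENNReal.pow_le_pow_left_iff two_ne_zero).1 ?_
        rw [mul_pow, hM]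
        exact hS x
    _ = M := hM

end HilbertBasis

section Projections

theorem sub_mul_self_mul_self {A : Type*} [Ring A] [Algebra ℝ A] {P Q : A} {k : ℝ}
    (hP : P * P = P) (hQ : Q * Q = Q) (hPQP : P * Q * P = k • P) (hQPQ : Q * P * Q = k • Q) :
    (P - Q) * (P - Q) * (P - Q) = (1 - k) • (P - Q) := by
  simp only [sub_mul, mul_sub, hP, hQ, hPQP, hQPQ, mul_assoc P Q Q, mul_assoc Q P P,
    sub_smul, one_smul, smul_sub]
  abel

theorem abs_eq_inv_smul_mul_self {A : Type*} [CStarAlgebra A] [PartialOrder A] [StarOrderedRing A]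
    {a : A} (ha : IsSelfAdjoint a) {d : ℝ} (hd : 0 ≤ d) (h : a * a * a = (d * d) • a) :
    CFC.abs a = d⁻¹ • (a * a) := by
  have hnonneg : 0 ≤ a * a := ha.mul_self_nonneg
  obtain rfl | hd' := hd.eq_or_lt
  · have hsq : a * a = 0 := by
      rw [← CStarRing.star_mul_self_eq_zero_iff, hnonneg.isSelfAdjoint.star_eq, ← mul_assoc, h]
      simp
    simp [CFC.abs, ha.star_eq, hsq]
  · rw [CFC.abs, ha.star_eq]
    refine CFC.sqrt_unique ?_ (smul_nonneg (inv_nonneg.2 hd) hnonneg)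
    rw [smul_mul_smul_comm, ← mul_assoc, h, smul_mul_assoc, smul_smul,
      show d⁻¹ * d⁻¹ * (d * d) = 1 by field_simp, one_smul]

variable {H : Type*} [NormedAddCommGroup H] [InnerProductSpace ℂ H]

theorem proj_apply (ψ x : H) : proj ψ x = inner ℂ ψ x • ψ := rfl

theorem proj_real_smul (s : ℝ) (ψ : H) : proj (s • ψ) = (s ^ 2) • proj ψ := by
  ext x
  simp only [proj_apply, smul_apply, inner_smul_left, ← Complex.coe_smul, Complex.conj_ofReal]
  push_cast
  module

theorem proj_mul_self {ψ : H} (hψ : ‖ψ‖ = 1) : proj ψ * proj ψ = proj ψ :=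
  isIdempotentElem_rankOne_self hψ

theorem proj_mul_proj (η ψ : H) : proj η * proj ψ = inner ℂ η ψ • rankOne ℂ η ψ :=
  rankOne_comp_rankOne η η ψ ψ

theorem proj_mul_proj_mul_proj (η ψ : H) :
    proj η * proj ψ * proj η = (‖inner ℂ η ψ‖ ^ 2) • proj η := by
  ext x
  simp only [proj_apply, mul_apply_eq_comp, smul_apply, inner_smul_right, smul_smul,
    ← Complex.coe_smul]
  congr 1
  push_cast
  rw [← Complex.mul_conj', inner_conj_symm]
  ring

theorem proj_isPositive (ψ : H) : (proj ψ).IsPositive := isPositive_rankOne_self ψ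

end Projections

section Trace

variable {ι 𝕜 E : Type*} [RCLike 𝕜] [NormedAddCommGroup E] [InnerProductSpace 𝕜 E]
  {H : Type*} [NormedAddCommGroup H] [InnerProductSpace ℂ H]

/-- The operator `T` has trace `t` with respect to the Hilbert basis `b`: its diagonal matrix
entries sum to `t`. -/
def HasTrace (b : HilbertBasis ι 𝕜 E) (T : E →L[𝕜] E) (t : 𝕜) : Prop :=
  HasSum (fun i => inner 𝕜 (b i) (T (b i))) t

namespace HasTrace

variable {b : HilbertBasis ι 𝕜 E} {S T : E →L[𝕜] E} {s t : 𝕜}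

theorem add (hS : HasTrace b S s) (hT : HasTrace b T t) : HasTrace b (S + T) (s + t) := by
  simpa [HasTrace, inner_add_right] using HasSum.add hS hT

theorem sub (hS : HasTrace b S s) (hT : HasTrace b T t) : HasTrace b (S - T) (s - t) := by
  simpa [HasTrace, inner_sub_right] using HasSum.sub hS hT

theorem smul (c : 𝕜) (hT : HasTrace b T t) : HasTrace b (c • T) (c * t) := by
  simpa [HasTrace, inner_smul_right] using HasSum.mul_left c hT

theorem real_smul {b : HilbertBasis ι ℂ H} {T : H →L[ℂ] H} {t : ℂ} (c : ℝ) (hT : HasTrace b T t) :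
    HasTrace b (c • T) (c * t) := by
  rw [← Complex.coe_smul]
  exact hT.smul _

end HasTrace

theorem hasTrace_rankOne (b : HilbertBasis ι 𝕜 E) (x y : E) :
    HasTrace b (rankOne 𝕜 x y) (inner 𝕜 y x) := by
  simpa [HasTrace, inner_smul_right] using b.hasSum_inner_mul_inner y x

theorem hasTrace_proj (b : HilbertBasis ι ℂ H) {ψ : H} (hψ : ‖ψ‖ = 1) : HasTrace b (proj ψ) 1 := by
  simpa [proj, hψ] using hasTrace_rankOne b ψ ψ

theorem hasTrace_proj_mul_proj (b : HilbertBasis ι ℂ H) (η ψ : H) :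
    HasTrace b (proj η * proj ψ) (‖inner ℂ η ψ‖ ^ 2 : ℝ) := by
  have h := (hasTrace_rankOne b η ψ).smul (inner ℂ η ψ)
  rwa [← proj_mul_proj, ← inner_conj_symm ψ η, Complex.mul_conj', ← Complex.ofReal_pow] at h

end Trace

section TraceNorm

variable {H : Type*} [NormedAddCommGroup H] [InnerProductSpace ℂ H] [CompleteSpace H]

theorem traceNorm_eq_of_hasTrace_abs {b : HilbertBasis ℕ ℂ H} {T : H →L[ℂ] H} {t : ℝ}
    (h : HasTrace b (CFC.abs T) t) : traceNorm b T = ENNReal.ofReal t := by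
  have hre := Complex.hasSum_re h
  have hpos (n : ℕ) : 0 ≤ (inner ℂ (b n) (CFC.abs T (b n))).re :=
    ((ContinuousLinearMap.nonneg_iff_isPositive _).1
      (CFC.abs_nonneg T)).re_inner_nonneg_right (b n)
  rw [traceNorm, ← ENNReal.ofReal_tsum_of_nonneg hpos hre.summable, hre.tsum_eq,
    Complex.ofReal_re]

theorem enorm_le_traceNorm (b : HilbertBasis ℕ ℂ H) (T : H →L[ℂ] H) : ‖T‖ₑ ≤ traceNorm b T := by
  set S := CFC.sqrt (CFC.abs T)
  have hS : IsSelfAdjoint S := (CFC.sqrt_nonneg _).isSelfAdjoint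
  have hSS : S * S = CFC.abs T := CFC.sqrt_mul_sqrt_self _ (CFC.abs_nonneg T)
  have hnorm : ‖T‖ = ‖S‖ ^ 2 := by
    rw [← CFC.norm_abs, ← hSS, sq, ← CStarRing.norm_star_mul_self, hS.star_eq]
  have hentry (n : ℕ) : (inner ℂ (b n) (CFC.abs T (b n))).re = ‖S.adjoint (b n)‖ ^ 2 := by
    rw [← hSS, hS.adjoint_eq, mul_apply_eq_comp, ← hS.adjoint_eq, S.adjoint_inner_right,
      hS.adjoint_eq]
    exact inner_self_eq_norm_sq (𝕜 := ℂ) _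
  calc ‖T‖ₑ = ‖S‖ₑ ^ 2 := by
        rw [← ofReal_norm, hnorm, ENNReal.ofReal_pow (norm_nonneg _), ofReal_norm]
    _ ≤ ∑' n, ‖S.adjoint (b n)‖ₑ ^ 2 := enorm_sq_le_tsum_enorm_adjoint_sq b S
    _ = traceNorm b T := by
        simp only [traceNorm, hentry, ENNReal.ofReal_pow (norm_nonneg _), ofReal_norm]

theorem TraceTendsto.tendsto {b : HilbertBasis ℕ ℂ H} {ξ : ℕ → (H →L[ℂ] H)} {ρ : H →L[ℂ] H}
    (h : TraceTendsto b ξ ρ) : Tendsto ξ atTop (𝓝 ρ) := by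
  rw [tendsto_iff_edist_tendsto_0]
  refine tendsto_of_tendsto_of_tendsto_of_le_of_le tendsto_const_nhds h (fun _ => zero_le)
    fun k => ?_
  rw [edist_eq_enorm_sub]
  exact enorm_le_traceNorm b _

theorem traceNorm_proj_sub_proj (b : HilbertBasis ℕ ℂ H) {η ψ : H} (hη : ‖η‖ = 1)
    (hψ : ‖ψ‖ = 1) :
    traceNorm b (proj η - proj ψ) = ENNReal.ofReal (2 * √(1 - ‖inner ℂ η ψ‖ ^ 2)) := by
  set T := proj η - proj ψ
  set d := √(1 - ‖inner ℂ η ψ‖ ^ 2)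
  have hd : d * d = 1 - ‖inner ℂ η ψ‖ ^ 2 := by
    refine Real.mul_self_sqrt (sub_nonneg.2 (pow_le_one₀ (norm_nonneg _) ?_))
    simpa [hη, hψ] using norm_inner_le_norm (𝕜 := ℂ) η ψ
  have hcube : T * T * T = (d * d) • T := by
    rw [hd]
    refine sub_mul_self_mul_self (proj_mul_self hη) (proj_mul_self hψ)
      (proj_mul_proj_mul_proj η ψ) ?_
    rw [norm_inner_symm]
    exact proj_mul_proj_mul_proj ψ η
  have habs : CFC.abs T = d⁻¹ • (T * T) := abs_eq_inv_smul_mul_self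
    ((proj_isPositive η).isSelfAdjoint.sub (proj_isPositive ψ).isSelfAdjoint)
    (Real.sqrt_nonneg _) hcube
  have hsq : T * T = proj η - proj η * proj ψ - (proj ψ * proj η - proj ψ) := by
    simp only [T, mul_sub, sub_mul, proj_mul_self hη, proj_mul_self hψ]
    abel
  refine traceNorm_eq_of_hasTrace_abs ?_
  rw [habs, hsq]
  convert! (((hasTrace_proj b hη).sub (hasTrace_proj_mul_proj b η ψ)).sub
    ((hasTrace_proj_mul_proj b ψ η).sub (hasTrace_proj b hψ))).real_smul d⁻¹ using 1
  rw [norm_inner_symm ψ η]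
  obtain hd0 | hd0 := eq_or_ne d 0
  · simp [hd0]
  · have hnum : (1 - ‖inner ℂ η ψ‖ ^ 2) - (‖inner ℂ η ψ‖ ^ 2 - 1) = 2 * (d * d) := by
      rw [hd]; ring
    norm_cast
    rw [hnum]
    field_simp

theorem traceTendsto_proj (b : HilbertBasis ℕ ℂ H) {η : ℕ → H} {ψ : H} (hη : ∀ k, ‖η k‖ = 1)
    (hψ : ‖ψ‖ = 1) (h : Tendsto η atTop (𝓝 ψ)) :
    TraceTendsto b (fun k => proj (η k)) (proj ψ) := by
  simp only [TraceTendsto, traceNorm_proj_sub_proj b (hη _) hψ]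
  have hcont : Continuous fun x : H => ENNReal.ofReal (2 * √(1 - ‖inner ℂ x ψ‖ ^ 2)) :=
    ENNReal.continuous_ofReal.comp (by fun_prop)
  simpa [Function.comp_def, hψ] using (hcont.tendsto ψ).comp h

theorem subset_traceClosure (b : HilbertBasis ℕ ℂ H) (S : Set (H →L[ℂ] H)) :
    S ⊆ traceClosure b S :=
  fun σ hσ => ⟨fun _ => σ, fun _ => hσ, by simp [TraceTendsto, traceNorm]⟩

end TraceNorm

section NormedSpace

variable {E ι : Type*} [NormedAddCommGroup E] [NormedSpace ℝ E]

theorem norm_le_one_of_mem_closure_convexHull {f : ι → E} (hf : ∀ i, ‖f i‖ = 1)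
    {v : E} (hv : v ∈ closure (convexHull ℝ (Set.range f))) : ‖v‖ ≤ 1 := by
  rw [← mem_closedBall_zero_iff]
  refine closure_minimal (convexHull_min ?_ (convex_closedBall 0 1)) Metric.isClosed_closedBall hv
  rintro _ ⟨i, rfl⟩
  exact mem_closedBall_zero_iff.2 (hf i).le

theorem continuousAt_normalize {v : E} (hv : v ≠ 0) : ContinuousAt NormedSpace.normalize v :=
  (continuousAt_id.norm.inv₀ (norm_ne_zero_iff.2 hv)).smul continuousAt_id

end NormedSpace

section Expectation

variable {H : Type*} [NormedAddCommGroup H] [InnerProductSpace ℂ H]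

/-- The functional `T ↦ Re ⟨h, T h⟩`, as a continuous real-linear map. -/
def expectation (h : H) : (H →L[ℂ] H) →L[ℝ] ℝ :=
  Complex.reCLM.comp (((innerSL ℂ h).comp (ContinuousLinearMap.apply ℂ H h)).restrictScalars ℝ)

theorem expectation_proj (h ψ : H) : expectation h (proj ψ) = ‖inner ℂ h ψ‖ ^ 2 := by
  change (inner ℂ h (inner ℂ ψ h • ψ)).re = _
  rw [inner_smul_right, ← inner_conj_symm ψ h, Complex.conj_mul', ← Complex.ofReal_pow,
    Complex.ofReal_re]

theorem expectation_nonneg {T : H →L[ℂ] H} (hT : T.IsPositive) (h : H) : 0 ≤ expectation h T :=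
  hT.re_inner_nonneg_right h

end Expectation

section Density

variable {H : Type*} [NormedAddCommGroup H] [InnerProductSpace ℂ H]

theorem isDensity_proj (b : HilbertBasis ℕ ℂ H) {ψ : H} (hψ : ‖ψ‖ = 1) : IsDensity b (proj ψ) :=
  ⟨proj_isPositive ψ, hasTrace_proj b hψ⟩

variable [CompleteSpace H]

theorem convex_setOf_isDensity (b : HilbertBasis ℕ ℂ H) : Convex ℝ {ρ | IsDensity b ρ} := by
  rintro σ ⟨hσ, hσ'⟩ τ ⟨hτ, hτ'⟩ p q hp hq hpq
  rw [← ContinuousLinearMap.nonneg_iff_isPositive] at hσ hτ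
  refine ⟨(ContinuousLinearMap.nonneg_iff_isPositive _).1
    (add_nonneg (smul_nonneg hp hσ) (smul_nonneg hq hτ)),
    (?_ : HasTrace b _ 1)⟩
  convert! (HasTrace.real_smul p hσ').add (HasTrace.real_smul q hτ') using 1
  rw [mul_one, mul_one, ← Complex.ofReal_add, hpq, Complex.ofReal_one]

theorem isDensity_inv_smul_smul_sub {b : HilbertBasis ℕ ℂ H} {σ ξ : H →L[ℂ] H} {μ : ℝ}
    (hμ : 1 < μ) (hσ : IsDensity b σ) (hξ : IsDensity b ξ) (h : ξ ≤ μ • σ) :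
    IsDensity b ((μ - 1)⁻¹ • (μ • σ - ξ)) := by
  refine ⟨(ContinuousLinearMap.nonneg_iff_isPositive _).1
    (smul_nonneg (inv_nonneg.2 (sub_nonneg.2 hμ.le)) (sub_nonneg.2 h)),
    (?_ : HasTrace b _ 1)⟩
  convert! ((HasTrace.real_smul μ hσ.2).sub hξ.2).real_smul (μ - 1)⁻¹ using 1
  rw [mul_one, ← Complex.ofReal_one, ← Complex.ofReal_sub, ← Complex.ofReal_mul,
    inv_mul_cancel₀ (sub_pos.2 hμ).ne']

theorem convexOn_proj : ConvexOn ℝ Set.univ (proj : H → H →L[ℂ] H) := by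
  refine ⟨convex_univ, fun v _ w _ p q hp hq hpq => ?_⟩
  have hgap : p • proj v + q • proj w - proj (p • v + q • w) = (p * q) • proj (v - w) := by
    obtain rfl : q = 1 - p := by linarith
    ext x
    simp only [add_apply, sub_apply, smul_apply, proj_apply, ← Complex.coe_smul, inner_add_left,
      inner_sub_left, inner_smul_left, Complex.conj_ofReal]
    push_cast
    module
  rw [← sub_nonneg, hgap]
  exact smul_nonneg (mul_nonneg hp hq)
    ((ContinuousLinearMap.nonneg_iff_isPositive _).2 (proj_isPositive _))

end Density

section Robustness

variable {H : Type*} [NormedAddCommGroup H] [InnerProductSpace ℂ H] [CompleteSpace H]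
  {b : HilbertBasis ℕ ℂ H}

theorem robustness_le_of_le_smul {F : Set (H →L[ℂ] H)} {ρ : H →L[ℂ] H}
    {σ ξ : ℕ → (H →L[ℂ] H)} {μ : ℝ} (hμ : 1 < μ) (hσF : ∀ k, σ k ∈ F)
    (hσ : ∀ k, IsDensity b (σ k)) (hξ : ∀ k, IsDensity b (ξ k)) (hle : ∀ k, ξ k ≤ μ • σ k)
    (hlim : TraceTendsto b ξ ρ) : robustness b F ρ ≤ ENNReal.ofReal μ := by
  have hμ₁ : 0 < μ - 1 := sub_pos.2 hμ
  refine sInf_le ⟨(μ - 1).toNNReal, ξ, fun k => (μ - 1)⁻¹ • (μ • σ k - ξ k), ?_,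
    fun k => isDensity_inv_smul_smul_sub hμ (hσ k) (hξ k) (hle k), hlim, fun k => ?_⟩
  · change _ = 1 + ENNReal.ofReal (μ - 1)
    rw [← ENNReal.ofReal_one, ← ENNReal.ofReal_add zero_le_one hμ₁.le, add_sub_cancel]
  · rw [Real.coe_toNNReal _ hμ₁.le, smul_inv_smul₀ hμ₁.ne', add_sub_cancel, add_sub_cancel,
      inv_smul_smul₀ (zero_lt_one.trans hμ).ne']
    exact hσF k

/-- The closed mixtures of a family of vectors `f`: the trace-norm closed convex hull of the
operators `|f i⟩⟨f i|`. The classical states are the closed mixtures of the coherent states. -/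
def closedMixtures (b : HilbertBasis ℕ ℂ H) {ι : Type*} (f : ι → H) : Set (H →L[ℂ] H) :=
  traceClosure b (convexHull ℝ (Set.range fun i => proj (f i)))

theorem expectation_le_robustness {F : Set (H →L[ℂ] H)} {h : H}
    (hF : ∀ σ ∈ F, expectation h σ ≤ 1) (ρ : H →L[ℂ] H) :
    ENNReal.ofReal (expectation h ρ) ≤ robustness b F ρ := by
  refine le_sInf ?_
  rintro _ ⟨lam, ξ, τ, rfl, hτ, hξ, hfree⟩
  have hbound (k : ℕ) : expectation h (ξ k) ≤ 1 + lam := by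
    have hk := hF _ (hfree k)
    rw [map_smul, map_add, map_smul, smul_eq_mul, inv_mul_le_iff₀ (by positivity), mul_one] at hk
    have hτk := smul_nonneg lam.2 (expectation_nonneg (hτ k).1 h)
    exact (le_add_of_nonneg_right hτk).trans hk
  have hρ : expectation h ρ ≤ 1 + lam :=
    le_of_tendsto' (((expectation h).continuous.tendsto ρ).comp hξ.tendsto) hbound
  calc ENNReal.ofReal (expectation h ρ) ≤ ENNReal.ofReal (1 + lam) := ENNReal.ofReal_le_ofReal hρ
    _ = 1 + lam := by
      rw [ENNReal.ofReal_add zero_le_one lam.coe_nonneg, ENNReal.ofReal_one,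
        ENNReal.ofReal_coe_nnreal]

theorem traceClosure_subset_closure (S : Set (H →L[ℂ] H)) : traceClosure b S ⊆ closure S := by
  rintro σ ⟨c, hc, hlim⟩
  exact mem_closure_of_tendsto hlim.tendsto (Eventually.of_forall hc)

variable {ι : Type*} {f : ι → H}

theorem expectation_le_one_of_mem_closedMixtures {h : H} (hf : ∀ i, ‖inner ℂ h (f i)‖ ≤ 1)
    {σ : H →L[ℂ] H} (hσ : σ ∈ closedMixtures b f) : expectation h σ ≤ 1 := by
  have hhull : convexHull ℝ (Set.range fun i => proj (f i)) ⊆ {T | expectation h T ≤ 1} := by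
    refine convexHull_min ?_ (convex_halfSpace_le (expectation h).toLinearMap.isLinear 1)
    rintro _ ⟨i, rfl⟩
    exact (expectation_proj h (f i)).trans_le (pow_le_one₀ (norm_nonneg _) (hf i))
  exact closure_minimal hhull (isClosed_le (expectation h).continuous continuous_const)
    (traceClosure_subset_closure _ hσ)

theorem sq_norm_inner_le_robustness {h : H} (hf : ∀ i, ‖inner ℂ h (f i)‖ ≤ 1) (ψ : H) :
    ENNReal.ofReal (‖inner ℂ h ψ‖ ^ 2) ≤ robustness b (closedMixtures b f) (proj ψ) := by
  rw [← expectation_proj]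
  exact expectation_le_robustness (fun _ => expectation_le_one_of_mem_closedMixtures hf) _

theorem exists_proj_le_of_mem_convexHull {v : H} (hv : v ∈ convexHull ℝ (Set.range f)) :
    ∃ σ ∈ convexHull ℝ (Set.range fun i => proj (f i)), proj v ≤ σ := by
  refine convexHull_min (t := {v | ∃ σ ∈ convexHull ℝ (Set.range fun i => proj (f i)),
    proj v ≤ σ}) ?_ ?_ hv
  · rintro _ ⟨i, rfl⟩
    exact ⟨proj (f i), subset_convexHull ℝ _ ⟨i, rfl⟩, le_rfl⟩
  · rintro v ⟨σ, hσ, hvσ⟩ w ⟨τ, hτ, hwτ⟩ p q hp hq hpq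
    refine ⟨p • σ + q • τ, convex_convexHull ℝ _ hσ hτ hp hq hpq, ?_⟩
    calc proj (p • v + q • w) ≤ p • proj v + q • proj w :=
          convexOn_proj.2 (Set.mem_univ v) (Set.mem_univ w) hp hq hpq
      _ ≤ p • σ + q • τ := by gcongr

theorem exists_proj_normalize_le_smul {μ : ℝ} {u : H}
    (hu : u ∈ convexHull ℝ (Set.range f)) (hμ : 1 < μ * ‖u‖ ^ 2) :
    ∃ σ ∈ convexHull ℝ (Set.range fun i => proj (f i)),
      proj (NormedSpace.normalize u) ≤ μ • σ := by
  have hu₀ : 0 < ‖u‖ ^ 2 := by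
    refine (sq_nonneg _).lt_of_ne fun h => ?_
    rw [← h] at hμ
    norm_num at hμ
  obtain ⟨σ, hσ, hle⟩ := exists_proj_le_of_mem_convexHull hu
  refine ⟨σ, hσ, ?_⟩
  have hσ₀ : 0 ≤ σ :=
    ((ContinuousLinearMap.nonneg_iff_isPositive _).2 (proj_isPositive u)).trans hle
  calc proj (NormedSpace.normalize u) = (‖u‖ ^ 2)⁻¹ • proj u := by
        rw [NormedSpace.normalize, proj_real_smul, inv_pow]
    _ ≤ (‖u‖ ^ 2)⁻¹ • σ := by gcongr
    _ ≤ μ • σ := by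
        gcongr
        exact ((inv_lt_iff_one_lt_mul₀ hu₀).2 hμ).le

theorem robustness_proj_normalize_le_of_lt (hf : ∀ i, ‖f i‖ = 1) {v : H}
    (hv : v ∈ closure (convexHull ℝ (Set.range f))) (hv₀ : v ≠ 0) {μ : ℝ}
    (hμ : (‖v‖ ^ 2)⁻¹ < μ) :
    robustness b (closedMixtures b f) (proj (NormedSpace.normalize v)) ≤ ENNReal.ofReal μ := by
  have hμ₁ : 1 < μ := lt_of_le_of_lt ((one_le_inv₀ (by positivity)).2
    (pow_le_one₀ (norm_nonneg _) (norm_le_one_of_mem_closure_convexHull hf hv))) hμ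
  have hopen : IsOpen {u : H | 1 < μ * ‖u‖ ^ 2} := isOpen_lt continuous_const (by fun_prop)
  have hvμ : 1 < μ * ‖v‖ ^ 2 := (inv_lt_iff_one_lt_mul₀ (by positivity)).1 hμ
  obtain ⟨u, hu, hlim⟩ := mem_closure_iff_seq_limit.1 (hopen.inter_closure ⟨hvμ, hv⟩)
  have hu₀ (k : ℕ) : u k ≠ 0 := by
    rintro h
    have := (hu k).1
    norm_num [h] at this
  choose σ hσ hle using fun k => exists_proj_normalize_le_smul (hu k).2 (hu k).1
  have hdensity : convexHull ℝ (Set.range fun i => proj (f i)) ⊆ {σ | IsDensity b σ} :=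
    convexHull_min (Set.range_subset_iff.2 fun i => isDensity_proj b (hf i))
      (convex_setOf_isDensity b)
  have hnorm {w : H} (hw : w ≠ 0) : ‖NormedSpace.normalize w‖ = 1 :=
    NormedSpace.norm_normalize_eq_one_iff.2 hw
  exact robustness_le_of_le_smul hμ₁ (fun k => subset_traceClosure b _ (hσ k))
    (fun k => hdensity (hσ k)) (fun k => isDensity_proj b (hnorm (hu₀ k))) hle
    (traceTendsto_proj b (fun k => hnorm (hu₀ k)) (hnorm hv₀)
      ((continuousAt_normalize hv₀).tendsto.comp hlim))

theorem robustness_proj_normalize_le (hf : ∀ i, ‖f i‖ = 1) {v : H}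
    (hv : v ∈ closure (convexHull ℝ (Set.range f))) (hv₀ : v ≠ 0) :
    robustness b (closedMixtures b f) (proj (NormedSpace.normalize v)) ≤
      ENNReal.ofReal (‖v‖ ^ 2)⁻¹ :=
  ge_of_tendsto ((ENNReal.continuous_ofReal.tendsto _).mono_left
      (nhdsWithin_le_nhds (s := Set.Ioi (‖v‖ ^ 2)⁻¹)))
    (eventually_mem_nhdsWithin.mono fun _ => robustness_proj_normalize_le_of_lt hf hv hv₀)

theorem robustness_proj_normalize_eq (hf : ∀ i, ‖f i‖ = 1) {v : H}
    (hv : v ∈ closure (convexHull ℝ (Set.range f))) {κ : Type*} {l : Filter κ} [l.NeBot]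
    {h : κ → H} (hh : ∀ᶠ k in l, ∀ i, ‖inner ℂ (h k) (f i)‖ ≤ 1)
    (hlim : Tendsto (fun k => ‖inner ℂ (h k) v‖) l (𝓝 1)) :
    robustness b (closedMixtures b f) (proj (NormedSpace.normalize v)) =
      ENNReal.ofReal (‖v‖ ^ 2)⁻¹ := by
  have hv₀ : v ≠ 0 := by
    rintro rfl
    simp at hlim
  refine le_antisymm (robustness_proj_normalize_le hf hv hv₀) ?_
  have hoverlap (k : κ) : ‖inner ℂ (h k) (NormedSpace.normalize v)‖ ^ 2 =
      (‖v‖ ^ 2)⁻¹ * ‖inner ℂ (h k) v‖ ^ 2 := by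
    simp [NormedSpace.normalize, inner_smul_right_eq_smul, mul_pow]
  have hlim' : Tendsto (fun k => ENNReal.ofReal (‖inner ℂ (h k) (NormedSpace.normalize v)‖ ^ 2)) l
      (𝓝 (ENNReal.ofReal (‖v‖ ^ 2)⁻¹)) := by
    simp only [hoverlap]
    simpa only [one_pow, mul_one] using
      ENNReal.tendsto_ofReal ((hlim.pow 2).const_mul (‖v‖ ^ 2)⁻¹)
  exact le_of_tendsto hlim' (hh.mono fun k hk => sq_norm_inner_le_robustness hk _)

end Robustness

section Orbit

variable {H : Type*} [NormedAddCommGroup H] [InnerProductSpace ℂ H]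

/-- The graph `G` of a possibly unbounded operator `A` is skew-symmetric: `⟨x, A x⟩ + ⟨A x, x⟩ = 0`
for every `x` in the domain of `A`. -/
def IsSkewSymmetric (G : Submodule ℂ (H × H)) : Prop :=
  ∀ p ∈ G, inner ℂ p.1 p.2 + inner ℂ p.2 p.1 = 0

theorem IsSkewSymmetric.topologicalClosure {G : Submodule ℂ (H × H)} (hG : IsSkewSymmetric G) :
    IsSkewSymmetric G.topologicalClosure :=
  closure_minimal hG (isClosed_eq (by fun_prop) continuous_const)

variable {G : Submodule ℂ (H × H)} {v : H} {ψ χ : ℝ → H}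

theorem IsExpOrbit.norm_eq (hG : IsSkewSymmetric G) (hψ : IsExpOrbit G v ψ) (t : ℝ) :
    ‖ψ t‖ = ‖v‖ := by
  have hderiv (s : ℝ) : HasDerivAt (fun s => inner ℂ (ψ s) (ψ s)) 0 s := by
    obtain ⟨w, hw, hψ'⟩ := hψ.2 s
    simpa only [hG _ hw] using hψ'.inner ℂ hψ'
  have hconst : inner ℂ (ψ t) (ψ t) = inner ℂ v v := by
    simpa only [hψ.1] using is_const_of_deriv_eq_zero (fun s => (hderiv s).differentiableAt)
      (fun s => (hderiv s).deriv) t 0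
  rw [norm_eq_sqrt_re_inner (𝕜 := ℂ), hconst, ← norm_eq_sqrt_re_inner]

theorem IsExpOrbit.unique (hG : IsSkewSymmetric G) (hψ : IsExpOrbit G v ψ)
    (hχ : IsExpOrbit G v χ) : ψ = χ := by
  have hsub : IsExpOrbit G 0 (ψ - χ) := by
    refine ⟨by simp [hψ.1, hχ.1], fun t => ?_⟩
    obtain ⟨w, hw, hψ'⟩ := hψ.2 t
    obtain ⟨u, hu, hχ'⟩ := hχ.2 t
    exact ⟨w - u, G.sub_mem hw hu, hψ'.sub hχ'⟩
  ext t
  simpa [sub_eq_zero] using hsub.norm_eq hG t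

end Orbit

section SqueezeGenerator

variable {H : Type*} [NormedAddCommGroup H] [InnerProductSpace ℂ H] (b : HilbertBasis ℕ ℂ H)

theorem inner_toFock_annihilation (f g : ℕ →₀ ℂ) :
    inner ℂ (toFock b f) (toFock b (annihilation g)) =
      inner ℂ (toFock b (creation f)) (toFock b g) := by
  induction f using Finsupp.induction_linear with
  | zero => simp
  | add f₁ f₂ h₁ h₂ => simp only [map_add, inner_add_left, h₁, h₂]
  | single m c =>
    induction g using Finsupp.induction_linear with
    | zero => simp
    | add g₁ g₂ h₁ h₂ => simp only [map_add, inner_add_right, h₁, h₂]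
    | single n d =>
      simp only [toFock, annihilation, creation, Finsupp.linearCombination_single, map_smul,
        inner_smul_left, inner_smul_right, orthonormal_iff_ite.1 b.orthonormal,
        Complex.conj_ofReal]
      obtain _ | n := n
      · simp
      · obtain rfl | hmn := eq_or_ne m n
        · simp [mul_comm]
        · simp [hmn]

theorem inner_toFock_creation (f g : ℕ →₀ ℂ) :
    inner ℂ (toFock b f) (toFock b (creation g)) =
      inner ℂ (toFock b (annihilation f)) (toFock b g) := by
  rw [← inner_conj_symm, ← inner_toFock_annihilation, inner_conj_symm]

theorem inner_toFock_squeezeGen (f g : ℕ →₀ ℂ) :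
    inner ℂ (toFock b f) (toFock b (squeezeGen g)) =
      -inner ℂ (toFock b (squeezeGen f)) (toFock b g) := by
  simp only [squeezeGen, LinearMap.smul_apply, LinearMap.sub_apply, LinearMap.comp_apply, map_smul,
    map_sub, inner_smul_left, inner_smul_right, inner_sub_left, inner_sub_right,
    inner_toFock_annihilation, inner_toFock_creation]
  simp only [map_div₀, map_one, map_ofNat]
  ring

theorem isSkewSymmetric_squeezeGraph : IsSkewSymmetric (squeezeGraph b) := by
  refine IsSkewSymmetric.topologicalClosure ?_
  rintro _ ⟨f, rfl⟩
  exact eq_neg_iff_add_eq_zero.1 (inner_toFock_squeezeGen b f f)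

theorem toFock_squeezeGen_single (n : ℕ) :
    toFock b (squeezeGen (Finsupp.single n 1)) =
      (√n * √(n - 1 : ℕ) / 2 : ℂ) • b (n - 2) - (√(n + 1) * √(n + 2) / 2 : ℂ) • b (n + 2) := by
  simp only [squeezeGen, annihilation, creation, toFock, LinearMap.smul_apply,
    LinearMap.sub_apply, LinearMap.comp_apply, Finsupp.linearCombination_single, map_smul,
    map_sub, one_smul, smul_sub, smul_smul]
  congr 2
  · ring
  · push_cast
    ring_nf

end SqueezeGenerator

section SqueezeCoeff

/-- The coefficients `√(2n)! / (2ⁿ n!)` of an unnormalised squeezed state in the even Fock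
states; the odd coefficients vanish. -/
def squeezeCoeff (n : ℕ) : ℝ := √((2 * n)! : ℝ) / (2 ^ n * n !)

theorem squeezeCoeff_nonneg (n : ℕ) : 0 ≤ squeezeCoeff n := by unfold squeezeCoeff; positivity

theorem squeezeCoeff_mul_sqrt (n : ℕ) :
    squeezeCoeff n * (√(2 * n + 1) * √(2 * n + 2)) = (2 * n + 2) * squeezeCoeff (n + 1) := by
  have hfactorial : √((2 * (n + 1))! : ℝ) = √((2 * n)! : ℝ) * (√(2 * n + 1) * √(2 * n + 2)) := by
    rw [← Real.sqrt_mul (by positivity), ← Real.sqrt_mul (by positivity), mul_add_one,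
      Nat.factorial_succ, Nat.factorial_succ]
    congr 1
    push_cast
    ring
  rw [squeezeCoeff, squeezeCoeff, hfactorial, Nat.factorial_succ]
  push_cast
  field_simp
  ring

theorem squeezeCoeff_succ_mul_sqrt (n : ℕ) :
    squeezeCoeff (n + 1) * (√(2 * n + 1) * √(2 * n + 2)) = (2 * n + 1) * squeezeCoeff n := by
  have hsq : (√(2 * n + 1) * √(2 * n + 2)) ^ 2 = ((2 * n + 1) * (2 * n + 2) : ℝ) := by
    rw [mul_pow, Real.sq_sqrt (by positivity), Real.sq_sqrt (by positivity)]
  refine mul_left_cancel₀ (show (2 * n + 2 : ℝ) ≠ 0 by positivity) ?_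
  linear_combination squeezeCoeff n * hsq -
    √(2 * n + 1) * √(2 * n + 2) * squeezeCoeff_mul_sqrt n

theorem squeezeCoeff_le_one (n : ℕ) : squeezeCoeff n ≤ 1 := by
  induction n with
  | zero => simp [squeezeCoeff]
  | succ n ih =>
    refine le_trans ?_ ih
    refine le_of_mul_le_mul_left ?_ (show (0 : ℝ) < 2 * n + 2 by positivity)
    rw [← squeezeCoeff_mul_sqrt, mul_comm]
    gcongr
    · exact squeezeCoeff_nonneg n
    calc √(2 * n + 1) * √(2 * n + 2) ≤ √(2 * n + 2) * √(2 * n + 2 : ℝ) := by gcongr; norm_num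
      _ = 2 * n + 2 := Real.mul_self_sqrt (by positivity)

end SqueezeCoeff

section SqueezeSeries

variable {H : Type*} [NormedAddCommGroup H] [InnerProductSpace ℂ H] (b : HilbertBasis ℕ ℂ H)

/-- The unnormalised squeezed state `∑ zⁿ √(2n)! / (2ⁿ n!) |2n⟩ = e^{z a†² / 2} |0⟩`; the series
converges for `‖z‖ < 1`. -/
def squeezeSeries (z : ℂ) : H := ∑' n : ℕ, (z ^ n * squeezeCoeff n : ℂ) • b (2 * n)

theorem squeezeSeries_zero : squeezeSeries b 0 = b 0 := by
  rw [squeezeSeries, tsum_eq_single 0 fun n hn => by simp [hn]]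
  simp [squeezeCoeff]

theorem norm_squeezeSeries_term_le (z : ℂ) (n : ℕ) :
    ‖(z ^ n * squeezeCoeff n : ℂ) • b (2 * n)‖ ≤ ‖z‖ ^ n := by
  rw [norm_smul, b.orthonormal.1, mul_one, norm_mul, norm_pow, Complex.norm_real,
    Real.norm_of_nonneg (squeezeCoeff_nonneg n)]
  exact mul_le_of_le_one_right (by positivity) (squeezeCoeff_le_one n)

theorem norm_squeezeSeries_term_le_of_mem_ball {ρ : ℝ} {z : ℂ} (hz : z ∈ Metric.ball 0 ρ) (n : ℕ) :
    ‖(z ^ n * squeezeCoeff n : ℂ) • b (2 * n)‖ ≤ ρ ^ n :=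
  (norm_squeezeSeries_term_le b z n).trans (by gcongr; exact (mem_ball_zero_iff.1 hz).le)

theorem hasDerivAt_squeezeSeries_term (n : ℕ) (z : ℂ) :
    HasDerivAt (fun w : ℂ => (w ^ n * squeezeCoeff n : ℂ) • b (2 * n))
      ((n * z ^ (n - 1) * squeezeCoeff n : ℂ) • b (2 * n)) z :=
  ((hasDerivAt_pow n z).mul_const _).smul_const _

variable [CompleteSpace H] {z : ℂ}

theorem hasSum_squeezeSeries (hz : ‖z‖ < 1) :
    HasSum (fun n : ℕ => (z ^ n * squeezeCoeff n : ℂ) • b (2 * n)) (squeezeSeries b z) :=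
  (Summable.of_norm_bounded (summable_geometric_of_lt_one (norm_nonneg z) hz)
    (norm_squeezeSeries_term_le b z)).hasSum

theorem differentiableAt_squeezeSeries (hz : ‖z‖ < 1) :
    DifferentiableAt ℂ (squeezeSeries b) z := by
  obtain ⟨ρ, hzρ, hρ⟩ := exists_between hz
  have hsummable : Summable (ρ ^ · : ℕ → ℝ) :=
    summable_geometric_of_lt_one ((norm_nonneg z).trans hzρ.le) hρ
  exact (Complex.differentiableOn_tsum_of_summable_norm hsummable
    (fun n w _ => (hasDerivAt_squeezeSeries_term b n w).differentiableAt.differentiableWithinAt)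
    Metric.isOpen_ball fun n w hw => norm_squeezeSeries_term_le_of_mem_ball b hw n).differentiableAt
      (Metric.isOpen_ball.mem_nhds (mem_ball_zero_iff.2 hzρ))

theorem hasSum_deriv_squeezeSeries (hz : ‖z‖ < 1) :
    HasSum (fun n : ℕ => (n * z ^ (n - 1) * squeezeCoeff n : ℂ) • b (2 * n))
      (deriv (squeezeSeries b) z) := by
  obtain ⟨ρ, hzρ, hρ⟩ := exists_between hz
  have hsummable : Summable (ρ ^ · : ℕ → ℝ) :=
    summable_geometric_of_lt_one ((norm_nonneg z).trans hzρ.le) hρ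
  simpa only [(hasDerivAt_squeezeSeries_term b _ z).deriv] using!
    Complex.hasSum_deriv_of_summable_norm hsummable
      (fun n w _ => (hasDerivAt_squeezeSeries_term b n w).differentiableAt.differentiableWithinAt)
      Metric.isOpen_ball (fun n w hw => norm_squeezeSeries_term_le_of_mem_ball b hw n)
      (mem_ball_zero_iff.2 hzρ)

theorem hasSum_lowering_squeezeSeries (hz : ‖z‖ < 1) :
    HasSum (fun n : ℕ => (z ^ n * squeezeCoeff n * (√(2 * n : ℕ) * √(2 * n - 1 : ℕ) / 2) : ℂ) •
        b (2 * n - 2))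
      ((z / 2) • squeezeSeries b z + z ^ 2 • deriv (squeezeSeries b) z) := by
  rw [← hasSum_nat_add_iff' 1]
  convert! ((hasSum_squeezeSeries b hz).const_smul (z / 2)).add
    ((hasSum_deriv_squeezeSeries b hz).const_smul (z ^ 2)) using 1
  · funext n
    have hcoeff := congrArg Complex.ofReal (squeezeCoeff_succ_mul_sqrt n)
    have hpow : (n * z ^ 2 * z ^ (n - 1) : ℂ) = n * z ^ (n + 1) := by
      cases n with
      | zero => simp
      | succ n => rw [Nat.add_sub_cancel]; ring
    rw [smul_smul, smul_smul, ← add_smul, show 2 * (n + 1) - 2 = 2 * n by omega,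
      show 2 * (n + 1) - 1 = 2 * n + 1 by omega, show 2 * (n + 1) = 2 * n + 2 by ring]
    push_cast at hcoeff ⊢
    congr 1
    linear_combination z ^ (n + 1) / 2 * hcoeff - squeezeCoeff n * hpow
  · simp

theorem hasSum_raising_squeezeSeries (hz : ‖z‖ < 1) :
    HasSum (fun n : ℕ =>
        (z ^ n * squeezeCoeff n * (√((2 * n : ℕ) + 1) * √((2 * n : ℕ) + 2) / 2) : ℂ) •
        b (2 * n + 2))
      (deriv (squeezeSeries b) z) := by
  convert! (hasSum_nat_add_iff' 1).2 (hasSum_deriv_squeezeSeries b hz) using 1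
  · funext n
    have hcoeff := congrArg Complex.ofReal (squeezeCoeff_mul_sqrt n)
    rw [Nat.add_sub_cancel, mul_add_one]
    push_cast at hcoeff ⊢
    congr 1
    linear_combination z ^ n / 2 * hcoeff
  · simp

theorem squeezeSeries_mem_squeezeGraph (hz : ‖z‖ < 1) :
    (squeezeSeries b z, (z / 2) • squeezeSeries b z + (z ^ 2 - 1) • deriv (squeezeSeries b) z) ∈
      squeezeGraph b := by
  have hsum := (hasSum_squeezeSeries b hz).prodMk
    ((hasSum_lowering_squeezeSeries b hz).sub (hasSum_raising_squeezeSeries b hz))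
  rw [sub_smul, one_smul, ← add_sub_assoc]
  refine (Submodule.isClosed_topologicalClosure _).mem_of_tendsto hsum
    (Eventually.of_forall fun s => Submodule.sum_mem _ fun n _ => Submodule.le_topologicalClosure _
      ⟨(z ^ n * squeezeCoeff n : ℂ) • Finsupp.single (2 * n) 1, ?_⟩)
  rw [map_smul, LinearMap.prod_apply]
  simp only [Function.prod_apply, LinearMap.comp_apply, toFock_squeezeGen_single, Prod.smul_mk,
    smul_sub, smul_smul]
  rw [toFock, Finsupp.linearCombination_single, one_smul]

end SqueezeSeries

section SqueezedVacuum

theorem hasDerivAt_tanh (t : ℝ) : HasDerivAt Real.tanh (1 - Real.tanh t ^ 2) t := by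
  rw [funext Real.tanh_eq_sinh_div_cosh]
  convert! (Real.hasDerivAt_sinh t).div (Real.hasDerivAt_cosh t) (Real.cosh_pos t).ne' using 1
  field_simp [(Real.cosh_pos t).ne']

theorem hasDerivAt_inv_sqrt_cosh (t : ℝ) :
    HasDerivAt (fun s => (√(Real.cosh s))⁻¹) (-(Real.tanh t / 2) * (√(Real.cosh t))⁻¹) t := by
  have hcosh := Real.cosh_pos t
  convert! ((Real.hasDerivAt_cosh t).sqrt hcosh.ne').inv (Real.sqrt_ne_zero'.2 hcosh) using 1
  rw [Real.sq_sqrt hcosh.le, Real.tanh_eq_sinh_div_cosh]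
  field_simp

variable {H : Type*} [NormedAddCommGroup H] [InnerProductSpace ℂ H] (b : HilbertBasis ℕ ℂ H)

/-- The Fock expansion `(cosh t)^{-1/2} ∑ (-tanh t)ⁿ √(2n)! / (2ⁿ n!) |2n⟩` of the squeezed
vacuum. -/
def squeezedVacuum (t : ℝ) : H := (√(Real.cosh t))⁻¹ • squeezeSeries b (-Real.tanh t : ℝ)

variable [CompleteSpace H]

theorem isExpOrbit_squeezedVacuum :
    IsExpOrbit (squeezeGraph b) (b 0) (squeezedVacuum b) := by
  refine ⟨by simp [squeezedVacuum, squeezeSeries_zero], fun t => ?_⟩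
  have hz : ‖((-Real.tanh t : ℝ) : ℂ)‖ < 1 := by
    rw [Complex.norm_real, norm_neg]
    exact Real.abs_tanh_lt_one t
  refine ⟨_, (squeezeGraph b).smul_mem (((√(Real.cosh t))⁻¹ : ℝ) : ℂ)
    (squeezeSeries_mem_squeezeGraph b hz), ?_⟩
  have hseries := (differentiableAt_squeezeSeries b hz).hasDerivAt.scomp t
    (hasDerivAt_tanh t).neg.ofReal_comp
  convert! (hasDerivAt_inv_sqrt_cosh t).smul hseries using 1
  simp only [← Complex.coe_smul, Function.comp_apply, Pi.neg_apply]
  push_cast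
  module

theorem isSqueezedVacuum_iff {r : ℝ} {ζ : H} :
    IsSqueezedVacuum b r ζ ↔ ζ = squeezedVacuum b r := by
  refine ⟨?_, fun h => ⟨_, isExpOrbit_squeezedVacuum b, h.symm⟩⟩
  rintro ⟨ψ, hψ, rfl⟩
  rw [hψ.unique (isSkewSymmetric_squeezeGraph b) (isExpOrbit_squeezedVacuum b)]

theorem norm_squeezedVacuum (r : ℝ) : ‖squeezedVacuum b r‖ = 1 := by
  rw [(isExpOrbit_squeezedVacuum b).norm_eq (isSkewSymmetric_squeezeGraph b), b.orthonormal.1]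

end SqueezedVacuum

section Coherent

variable {H : Type*} [NormedAddCommGroup H] [InnerProductSpace ℂ H] (b : HilbertBasis ℕ ℂ H)

theorem inner_fock_coherent (α : ℂ) (n : ℕ) :
    inner ℂ (b n) (coherent b α) = coherentCoeff α n := by
  rw [← b.repr_apply_apply, coherent, LinearIsometryEquiv.apply_symm_apply]

theorem sq_norm_coherentCoeff (α : ℂ) (n : ℕ) :
    ‖coherentCoeff α n‖ ^ 2 = Real.exp (-‖α‖ ^ 2) * ((‖α‖ ^ 2) ^ n / n !) := by
  rw [coherentCoeff, norm_mul, norm_div, norm_pow, Complex.norm_real, Complex.norm_real,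
    Real.norm_of_nonneg (Real.exp_nonneg _), Real.norm_of_nonneg (Real.sqrt_nonneg _), mul_pow,
    div_pow, Real.sq_sqrt (by positivity), ← Real.exp_nat_mul, pow_right_comm]
  push_cast
  ring_nf

theorem norm_coherent (α : ℂ) : ‖coherent b α‖ = 1 := by
  have hsum := hasSum_norm_inner_sq b (coherent b α)
  simp only [inner_fock_coherent, sq_norm_coherentCoeff] at hsum
  have hexp := (NormedSpace.expSeries_div_hasSum_exp (‖α‖ ^ 2)).mul_left (Real.exp (-‖α‖ ^ 2))
  rw [← Real.exp_eq_exp_ℝ, ← Real.exp_add, neg_add_cancel, Real.exp_zero] at hexp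
  exact (pow_eq_one_iff_of_nonneg (norm_nonneg _) two_ne_zero).1 (hsum.unique hexp)

theorem inner_coherent_squeezeSeries [CompleteSpace H] (α : ℂ) {z : ℂ} (hz : ‖z‖ < 1) :
    inner ℂ (coherent b α) (squeezeSeries b z) =
      Real.exp (-‖α‖ ^ 2 / 2) * Complex.exp (z * (starRingEnd ℂ α) ^ 2 / 2) := by
  have hexp := (NormedSpace.expSeries_div_hasSum_exp
    (z * (starRingEnd ℂ α) ^ 2 / 2)).mul_left (Real.exp (-‖α‖ ^ 2 / 2) : ℂ)
  rw [← Complex.exp_eq_exp_ℂ] at hexp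
  refine ((innerSL ℂ (coherent b α)).hasSum (hasSum_squeezeSeries b hz)).unique ?_
  convert! hexp using 1
  funext n
  have hsqrt : (√((2 * n)! : ℝ) : ℂ) ≠ 0 := Complex.ofReal_ne_zero.2 (by positivity)
  rw [innerSL_apply_apply, inner_smul_right, ← inner_conj_symm, inner_fock_coherent,
    coherentCoeff, squeezeCoeff]
  simp only [map_mul, map_div₀, map_pow, Complex.conj_ofReal]
  push_cast
  rw [div_pow, mul_pow, ← pow_mul]
  field_simp

theorem norm_inner_squeezeSeries_coherent_le_one [CompleteSpace H] {z : ℂ} (hz : ‖z‖ < 1) (α : ℂ) :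
    ‖inner ℂ (squeezeSeries b z) (coherent b α)‖ ≤ 1 := by
  have hre : (z * (starRingEnd ℂ α) ^ 2 / 2).re ≤ ‖α‖ ^ 2 / 2 :=
    calc (z * (starRingEnd ℂ α) ^ 2 / 2).re ≤ ‖z * (starRingEnd ℂ α) ^ 2 / 2‖ :=
          Complex.re_le_norm _
      _ = ‖z‖ * (‖α‖ ^ 2 / 2) := by simp [mul_div_assoc]
      _ ≤ ‖α‖ ^ 2 / 2 := mul_le_of_le_one_left (by positivity) hz.le
  rw [norm_inner_symm, inner_coherent_squeezeSeries b α hz, norm_mul, Complex.norm_real,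
    Real.norm_of_nonneg (Real.exp_nonneg _), Complex.norm_exp, ← Real.exp_add, Real.exp_le_one_iff]
  linarith

theorem stronglyMeasurable_coherent : StronglyMeasurable (coherent b) := by
  have hcoeff (n : ℕ) : Continuous fun α => coherentCoeff α n := by
    unfold coherentCoeff
    fun_prop
  refine stronglyMeasurable_of_tendsto atTop
    (f := fun (N : ℕ) α => ∑ n ∈ Finset.range N, coherentCoeff α n • b n)
    (fun N => Continuous.stronglyMeasurable (by fun_prop)) (tendsto_pi_nhds.2 fun α => ?_)
  simpa only [b.repr_apply_apply, inner_fock_coherent] using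
    (b.hasSum_repr (coherent b α)).tendsto_sum_nat

theorem integrable_coherent {Ω : Type*} [MeasurableSpace Ω] {μ : Measure Ω} [IsFiniteMeasure μ]
    {f : Ω → ℂ} (hf : Measurable f) : Integrable (fun x => coherent b (f x)) μ :=
  Integrable.of_bound ((stronglyMeasurable_coherent b).comp_measurable hf).aestronglyMeasurable 1
    (Eventually.of_forall fun _ => (norm_coherent b _).le)

end Coherent

section GaussianMoments

theorem doubleFactorial_two_mul_sub_one (n : ℕ) :
    ((2 * n - 1)‼ : ℝ) = (2 * n)! / (2 ^ n * n !) := by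
  cases n with
  | zero => simp
  | succ n =>
    rw [eq_div_iff (by positivity), mul_comm, show 2 * (n + 1) - 1 = 2 * n + 1 by omega]
    exact_mod_cast Nat.doubleFactorial_two_mul (n + 1) ▸
      (Nat.factorial_eq_mul_doubleFactorial (2 * n + 1)).symm

theorem integral_pow_two_mul_mul_exp_neg_mul_sq (n : ℕ) {a : ℝ} (ha : 0 < a) :
    ∫ x : ℝ, x ^ (2 * n) * Real.exp (-a * x ^ 2) =
      (2 * n)! / ((4 * a) ^ n * n !) * √(Real.pi / a) := by
  have habs : ∫ x : ℝ, x ^ (2 * n) * Real.exp (-a * x ^ 2) =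
      2 * ∫ x in Set.Ioi (0 : ℝ), x ^ (2 * n) * Real.exp (-a * x ^ 2) := by
    rw [← integral_comp_abs]
    simp only [pow_mul, sq_abs]
  have hGamma := integral_rpow_mul_exp_neg_mul_rpow (p := 2) (q := (2 * n : ℕ)) (b := a)
    two_pos (neg_one_lt_zero.trans_le (Nat.cast_nonneg _)) ha
  simp only [Real.rpow_natCast, Real.rpow_two] at hGamma
  have hrpow : a ^ (-(((2 * n : ℕ) : ℝ) + 1) / 2) = (a ^ n * √a)⁻¹ := by
    rw [Real.sqrt_eq_rpow, ← Real.rpow_natCast, ← Real.rpow_add ha, ← Real.rpow_neg ha.le]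
    push_cast
    ring_nf
  rw [habs, hGamma, hrpow, show (((2 * n : ℕ) : ℝ) + 1) / 2 = n + 1 / 2 by push_cast; ring,
    Real.Gamma_nat_add_half, doubleFactorial_two_mul_sub_one, Real.sqrt_div' _ ha.le, mul_pow,
    show (4 : ℝ) ^ n = 2 ^ n * 2 ^ n by rw [← mul_pow]; norm_num]
  field_simp

theorem integral_pow_two_mul_mul_exp_gaussianReal (n : ℕ) {κ : ℝ} (hκ : -1 < κ) :
    ∫ x, x ^ (2 * n) * Real.exp (-κ * x ^ 2 / 2) ∂(gaussianReal 0 1) =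
      (2 * n)! / ((2 * (1 + κ)) ^ n * n !) * (√(1 + κ))⁻¹ := by
  have hpos : 0 < 1 + κ := by linarith
  have hdensity (x : ℝ) : gaussianPDFReal 0 1 x • (x ^ (2 * n) * Real.exp (-κ * x ^ 2 / 2)) =
      (√(2 * Real.pi))⁻¹ * (x ^ (2 * n) * Real.exp (-((1 + κ) / 2) * x ^ 2)) := by
    rw [show -((1 + κ) / 2) * x ^ 2 = -x ^ 2 / 2 + -κ * x ^ 2 / 2 by ring, Real.exp_add,
      gaussianPDFReal, smul_eq_mul]
    simp only [NNReal.coe_one, mul_one, sub_zero]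
    ring
  simp only [integral_gaussianReal_eq_integral_smul one_ne_zero, hdensity]
  rw [integral_const_mul, integral_pow_two_mul_mul_exp_neg_mul_sq n (by positivity),
    show Real.pi / ((1 + κ) / 2) = 2 * Real.pi / (1 + κ) by field_simp, Real.sqrt_div' _ hpos.le,
    show 4 * ((1 + κ) / 2) = 2 * (1 + κ) by ring]
  field_simp

theorem integral_gaussianReal_eq_zero_of_odd {E : Type*} [NormedAddCommGroup E] [NormedSpace ℝ E]
    {v : ℝ≥0} {f : ℝ → E} (hf : f.Odd) : ∫ x, f x ∂(gaussianReal 0 v) = 0 := by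
  have hneg : ∫ x, f x ∂((gaussianReal 0 v).map fun x => -x) = ∫ x, f (-x) ∂(gaussianReal 0 v) :=
    (Homeomorph.neg ℝ).measurableEmbedding.integral_map f
  rw [gaussianReal_map_neg, neg_zero, integral_congr_ae (Eventually.of_forall hf),
    integral_neg] at hneg
  have := IsAddTorsionFree.of_isTorsionFree ℝ E
  exact self_eq_neg.1 hneg

end GaussianMoments

section GaussianCoherent

variable {H : Type*} [NormedAddCommGroup H] [InnerProductSpace ℂ H] (b : HilbertBasis ℕ ℂ H) (c : ℂ)

/-- The superposition of the coherent states `|c x⟩` along a line through the origin, with `x`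
standard normal. Being a mixture of coherent vectors it lies in their closed convex hull, and it
is proportional to a squeezed vacuum. -/
def gaussianCoherent : H := ∫ x : ℝ, coherent b (c * x) ∂(gaussianReal 0 1)

theorem integrable_coherent_mul :
    Integrable (fun x : ℝ => coherent b (c * x)) (gaussianReal 0 1) :=
  integrable_coherent b (by fun_prop)

variable [CompleteSpace H]

theorem gaussianCoherent_mem_closure_convexHull :
    gaussianCoherent b c ∈ closure (convexHull ℝ (Set.range (coherent b))) :=
  (convex_convexHull ℝ _).closure.integral_mem isClosed_closure
    (Eventually.of_forall fun _ => subset_closure (subset_convexHull ℝ _ ⟨_, rfl⟩))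
    (integrable_coherent_mul b c)

theorem inner_fock_gaussianCoherent (m : ℕ) :
    inner ℂ (b m) (gaussianCoherent b c) = c ^ m / √(m ! : ℝ) *
      (∫ x : ℝ, x ^ m * Real.exp (-‖c‖ ^ 2 * x ^ 2 / 2) ∂(gaussianReal 0 1) : ℝ) := by
  have hcoeff (x : ℝ) : coherentCoeff (c * x) m =
      c ^ m / √(m ! : ℝ) * (x ^ m * Real.exp (-‖c‖ ^ 2 * x ^ 2 / 2) : ℝ) := by
    rw [coherentCoeff, norm_mul, Complex.norm_real, Real.norm_eq_abs, mul_pow, sq_abs, mul_pow,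
      neg_mul]
    push_cast
    ring
  rw [gaussianCoherent, ← integral_inner (integrable_coherent_mul b c)]
  simp only [inner_fock_coherent, hcoeff]
  rw [integral_const_mul, integral_complex_ofReal]

theorem inner_fock_even_gaussianCoherent (n : ℕ) :
    inner ℂ (b (2 * n)) (gaussianCoherent b c) =
      ((√(1 + ‖c‖ ^ 2))⁻¹ : ℝ) * ((c ^ 2 / (1 + ‖c‖ ^ 2 : ℝ)) ^ n * squeezeCoeff n) := by
  have hpos : 0 < 1 + ‖c‖ ^ 2 := by positivity
  have hne : ((1 + ‖c‖ ^ 2 : ℝ) : ℂ) ≠ 0 := Complex.ofReal_ne_zero.2 hpos.ne'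
  have hsqrt : (√((2 * n)! : ℝ) : ℂ) ≠ 0 := Complex.ofReal_ne_zero.2 (by positivity)
  have hfactorial : ((2 * n)! : ℂ) = (√((2 * n)! : ℝ) : ℂ) ^ 2 := by
    rw [← Complex.ofReal_pow, Real.sq_sqrt (by positivity), Complex.ofReal_natCast]
  rw [inner_fock_gaussianCoherent,
    integral_pow_two_mul_mul_exp_gaussianReal n (neg_one_lt_zero.trans_le (sq_nonneg ‖c‖)),
    squeezeCoeff]
  generalize 1 + ‖c‖ ^ 2 = w at hne ⊢
  push_cast
  rw [hfactorial, mul_pow, div_pow, ← pow_mul]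
  field_simp

theorem inner_fock_odd_gaussianCoherent (n : ℕ) :
    inner ℂ (b (2 * n + 1)) (gaussianCoherent b c) = 0 := by
  rw [inner_fock_gaussianCoherent, integral_gaussianReal_eq_zero_of_odd, Complex.ofReal_zero,
    mul_zero]
  intro x
  dsimp only
  rw [(odd_two_mul_add_one n).neg_pow, neg_sq, neg_mul]

theorem gaussianCoherent_eq_smul_squeezeSeries :
    gaussianCoherent b c =
      (√(1 + ‖c‖ ^ 2))⁻¹ • squeezeSeries b (c ^ 2 / (1 + ‖c‖ ^ 2 : ℝ)) := by
  have hz : ‖c ^ 2 / (1 + ‖c‖ ^ 2 : ℝ)‖ < 1 := by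
    rw [norm_div, norm_pow, Complex.norm_real, Real.norm_of_nonneg (by positivity),
      div_lt_one (by positivity)]
    linarith
  have hfock := b.hasSum_repr (gaussianCoherent b c)
  simp only [b.repr_apply_apply] at hfock
  rw [← (mul_right_injective₀ (two_ne_zero (α := ℕ))).hasSum_iff] at hfock
  · refine hfock.unique ?_
    rw [← Complex.coe_smul]
    convert! (hasSum_squeezeSeries b hz).const_smul (((√(1 + ‖c‖ ^ 2))⁻¹ : ℝ) : ℂ) using 1
    funext n
    rw [Function.comp_apply, inner_fock_even_gaussianCoherent, smul_smul]
  · intro m hm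
    obtain ⟨n, rfl | rfl⟩ := m.even_or_odd'
    · exact absurd ⟨n, rfl⟩ hm
    · rw [inner_fock_odd_gaussianCoherent, zero_smul]

theorem inner_squeezeSeries_gaussianCoherent {z : ℂ} (hz : ‖z‖ < 1) {κ : ℝ}
    (hκ : starRingEnd ℂ z * c ^ 2 = κ) :
    inner ℂ (squeezeSeries b z) (gaussianCoherent b c) = ((√(1 + (‖c‖ ^ 2 - κ)))⁻¹ : ℝ) := by
  have hκ_le : κ ≤ ‖c‖ ^ 2 :=
    calc κ ≤ ‖(κ : ℂ)‖ := (le_abs_self κ).trans_eq (Complex.norm_real κ).symm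
      _ = ‖z‖ * ‖c‖ ^ 2 := by rw [← hκ, norm_mul, RCLike.norm_conj, norm_pow]
      _ ≤ ‖c‖ ^ 2 := mul_le_of_le_one_left (sq_nonneg _) hz.le
  have hoverlap (x : ℝ) : inner ℂ (squeezeSeries b z) (coherent b (c * x)) =
      ((x ^ (2 * 0) * Real.exp (-(‖c‖ ^ 2 - κ) * x ^ 2 / 2) : ℝ) : ℂ) := by
    have hexponent : starRingEnd ℂ z * (c * x) ^ 2 / 2 = (κ * x ^ 2 / 2 : ℝ) := by
      push_cast
      rw [← hκ]
      ring
    rw [← inner_conj_symm, inner_coherent_squeezeSeries b _ hz, map_mul, Complex.conj_ofReal,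
      ← Complex.exp_conj, map_div₀, map_mul, map_pow, Complex.conj_conj, map_ofNat, hexponent,
      ← Complex.ofReal_exp, ← Complex.ofReal_mul, ← Real.exp_add, norm_mul, Complex.norm_real,
      Real.norm_eq_abs, mul_pow, sq_abs]
    ring_nf
  rw [gaussianCoherent, ← integral_inner (integrable_coherent_mul b c)]
  simp only [hoverlap]
  rw [integral_complex_ofReal, integral_pow_two_mul_mul_exp_gaussianReal 0 (by linarith)]
  simp

theorem robustness_normalize_gaussianCoherent :
    robustness b (classicalStates b) (proj (NormedSpace.normalize (gaussianCoherent b c))) =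
      ENNReal.ofReal (‖gaussianCoherent b c‖ ^ 2)⁻¹ := by
  obtain ⟨u, hu, hphase⟩ := RCLike.exists_norm_eq_mul_self (c ^ 2)
  let z (t : ℝ) : ℂ := t * starRingEnd ℂ u
  have hz {t : ℝ} (ht : |t| < 1) : ‖z t‖ < 1 := by
    rwa [norm_mul, RCLike.norm_conj, hu, mul_one, Complex.norm_real]
  have hκ (t : ℝ) : starRingEnd ℂ (z t) * c ^ 2 = (t * ‖c‖ ^ 2 : ℝ) := by
    rw [map_mul, Complex.conj_conj, Complex.conj_ofReal, mul_assoc, ← norm_pow]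
    push_cast
    exact congrArg _ hphase.symm
  have hmem : ∀ᶠ t : ℝ in 𝓝[<] 1, |t| < 1 := by
    filter_upwards [Ioo_mem_nhdsLT (neg_one_lt_zero.trans one_pos)] with t ht using abs_lt.2 ht
  refine robustness_proj_normalize_eq (norm_coherent b)
    (gaussianCoherent_mem_closure_convexHull b c) (l := 𝓝[<] (1 : ℝ))
    (h := fun t => squeezeSeries b (z t))
    (hmem.mono fun t ht => norm_inner_squeezeSeries_coherent_le_one b (hz ht)) ?_
  have hlim : Tendsto (fun t : ℝ => (√(1 + (‖c‖ ^ 2 - t * ‖c‖ ^ 2)))⁻¹) (𝓝[<] 1) (𝓝 1) := by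
    have hcont : ContinuousAt (fun t : ℝ => (√(1 + (‖c‖ ^ 2 - t * ‖c‖ ^ 2)))⁻¹) 1 :=
      ContinuousAt.inv₀ (by fun_prop) (by simp)
    simpa using hcont.tendsto.mono_left nhdsWithin_le_nhds
  refine hlim.congr' (hmem.mono fun t ht => ?_)
  dsimp only
  rw [inner_squeezeSeries_gaussianCoherent b c (hz ht) (hκ t), Complex.norm_real,
    Real.norm_of_nonneg (by positivity)]

end GaussianCoherent

section SqueezedVacuumRobustness

theorem exists_one_add_sq_norm_eq_and_sq_div_eq (r : ℝ) : ∃ c : ℂ,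
    1 + ‖c‖ ^ 2 = Real.exp |r| * Real.cosh r ∧
      c ^ 2 / (1 + ‖c‖ ^ 2 : ℝ) = (-Real.tanh r : ℝ) := by
  obtain ⟨c, hc⟩ := IsAlgClosed.exists_pow_nat_eq
    ((-(Real.exp |r| * Real.sinh r) : ℝ) : ℂ) two_pos
  have hnorm : 1 + ‖c‖ ^ 2 = Real.exp |r| * Real.cosh r := by
    rw [← norm_pow, hc, Complex.norm_real, norm_neg, norm_mul, Real.norm_of_nonneg
      (Real.exp_nonneg _), Real.norm_eq_abs, Real.abs_sinh, ← Real.cosh_abs r, Real.sinh_eq,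
      Real.cosh_eq, Real.exp_neg]
    field_simp
    ring
  refine ⟨c, hnorm, ?_⟩
  rw [hnorm, hc, ← Complex.ofReal_div, neg_div, mul_div_mul_left _ _ (Real.exp_ne_zero _),
    Real.tanh_eq_sinh_div_cosh]

variable {H : Type*} [NormedAddCommGroup H] [InnerProductSpace ℂ H] [CompleteSpace H]
  (b : HilbertBasis ℕ ℂ H)

theorem exists_gaussianCoherent_eq_smul_squeezedVacuum (r : ℝ) :
    ∃ c : ℂ, gaussianCoherent b c = (√(Real.exp |r|))⁻¹ • squeezedVacuum b r := by
  obtain ⟨c, hnorm, hratio⟩ := exists_one_add_sq_norm_eq_and_sq_div_eq r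
  refine ⟨c, ?_⟩
  rw [gaussianCoherent_eq_smul_squeezeSeries, hratio, hnorm, squeezedVacuum, smul_smul,
    Real.sqrt_mul (Real.exp_nonneg _), mul_inv]

theorem robustness_squeezedVacuum (r : ℝ) :
    robustness b (classicalStates b) (proj (squeezedVacuum b r)) =
      ENNReal.ofReal (Real.exp |r|) := by
  obtain ⟨c, hc⟩ := exists_gaussianCoherent_eq_smul_squeezedVacuum b r
  have hnormalize : NormedSpace.normalize (gaussianCoherent b c) = squeezedVacuum b r := by
    rw [hc, NormedSpace.normalize_smul_of_pos (by positivity),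
      NormedSpace.normalize_eq_self_of_norm_eq_one (norm_squeezedVacuum b r)]
  rw [← hnormalize, robustness_normalize_gaussianCoherent, hc, norm_smul, norm_squeezedVacuum,
    mul_one, Real.norm_of_nonneg (by positivity), inv_pow, inv_inv, Real.sq_sqrt (by positivity)]

end SqueezedVacuumRobustness

end SqueezedRobustness

end

theorem mainTheorem7_general {H : Type*} [NormedAddCommGroup H] [InnerProductSpace ℂ H]
    [CompleteSpace H] (b : HilbertBasis ℕ ℂ H) (r : ℝ) :
    (∃! ζ : H, SqueezedRobustness.IsSqueezedVacuum b r ζ) ∧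
      ∀ ζ : H, SqueezedRobustness.IsSqueezedVacuum b r ζ →
        SqueezedRobustness.robustness b (SqueezedRobustness.classicalStates b)
          (SqueezedRobustness.proj ζ) = ENNReal.ofReal (Real.exp |r|) := by
  simp only [SqueezedRobustness.isSqueezedVacuum_iff, existsUnique_eq, true_and, forall_eq]
  exact SqueezedRobustness.robustness_squeezedVacuum b r

theorem mainTheorem7 {H : Type*} [NormedAddCommGroup H] [InnerProductSpace ℂ H] [CompleteSpace H]
    (b : HilbertBasis ℕ ℂ H) (r : ℝ) (hr : 0 ≤ r) :
    (∃! ζ : H, SqueezedRobustness.IsSqueezedVacuum b r ζ) ∧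
      ∀ ζ : H, SqueezedRobustness.IsSqueezedVacuum b r ζ →
        SqueezedRobustness.robustness b (SqueezedRobustness.classicalStates b)
          (SqueezedRobustness.proj ζ) = ENNReal.ofReal (Real.exp r) := by
  simpa only [abs_of_nonneg hr] using mainTheorem7_general b r
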